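/- Let $m,K\ge 1$ be integers, $n=mK$, and $p,q\in[0,1]$. Let the node set be partitioned into $K$ communities of size $m$ each, with true cluster matrix $X_0 = I_K\otimes E_m$, where $E_s$ denotes the $s\times s$ all-ones matrix. A symmetric random $n\times n$ matrix $A$ is drawn from the balanced planted partition model $\mathrm{PP}^{\mathrm{bal}}_{m,K}(p,q)$ if its entries strictly above the diagonal are independent $\{0,1\}$-valued variables, with $\mathbb P(A_{ij}=1)=p$ when $i\neq j$ belong to the same community and $\mathbb P(A_{ij}=1)=q$ when they belong to different communities (the diagonal of $A$ is arbitrary). With $\langle A,X\rangle=\mathrm{tr}(AX)$, SDP-$2'$ is the problem $$\max_X\ \langle A,X\rangle\quad\text{subject to}\quad \langle E_n,X\rangle=n^2/K,\quad \mathrm{diag}(X)=\mathbf 1_n,\quad X\ge 0\ \text{(entrywise)},\quad X\succeq 0 .$$ Put $\tilde p = pm/\log n$ and $\tilde q = qm/\log n$ (for $n \geq 2$). **Theorem (consistency of SDP-$2'$).** There are universal constants $C,C',c,r>0$ such that the following holds for all $m,K\ge1$ with $n=mK\ge2$, all $p,q\in[0,1]$ and all $c_1,c_2>0$. Let $$C_1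 = \max\{C',\tfrac49(c_1+1)\},\qquad C_2 = C+\max\{\sqrt{4(c_1+1)},\,3\sqrt{4(c_2+1)}\}.$$ If $A$ is drawn from $\mathrm{PP}^{\mathrm{bal}}_{m,K}(p,q)$, $\tilde p\ge C_1$ and $$\tilde p-\tilde q > C_2\bigl(\sqrt{\tilde p}+\sqrt{\tilde q K}\bigr),$$ then with probability at least $$1-c\,(Km^{-r}+n^{-r})-n^{-c_1}-2m^{-1}n^{-c_2}$$ the matrix $X_0$ is the unique solution of SDP-$2'$ with input $A$. -/

import Mathlib

open MeasureTheory ProbabilityTheory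
open scoped Kronecker

/-- The nodes of a balanced block model: the pair `(k, a)` is the `a`-th node of community `k`.
There are `K` communities of size `m`, hence `n = m * K` nodes. -/
abbrev Node (m K : ℕ) : Type := Fin K × Fin m

/-- The `n × n` matrix of all ones. -/
def allOnes (V : Type*) : Matrix V V ℝ := Matrix.of fun _ _ => 1

/-- The true cluster matrix `X₀ = I_K ⊗ E_m`. -/
def clusterMatrix (m K : ℕ) : Matrix (Node m K) (Node m K) ℝ :=
  (1 : Matrix (Fin K) (Fin K) ℝ) ⊗ₖ allOnes (Fin m)

/-- `A` is a random adjacency matrix drawn from the balanced planted partition model with `K`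
communities of size `m`, within-community edge probability `p` and between-community edge
probability `q`. The diagonal of `A` is left unrestricted: it carries no data. -/
structure IsBalancedPlantedPartition {Ω : Type*} [MeasurableSpace Ω] (μ : Measure Ω)
    (m K : ℕ) (p q : ℝ) (A : Ω → Matrix (Node m K) (Node m K) ℝ) : Prop where
  measurable : ∀ i j, Measurable fun ω => A ω i j
  symm : ∀ ω, (A ω).IsSymm
  binary : ∀ ω i j, i ≠ j → A ω i j = 0 ∨ A ω i j = 1
  prob_edge : ∀ i j, i ≠ j → μ.real {ω | A ω i j = 1} = if i.1 = j.1 then p else q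
  /-- The entries strictly above the diagonal (for the lexicographic order) are independent. -/
  indep : iIndepFun
    (fun (e : {e : Node m K × Node m K // toLex e.1 < toLex e.2}) ω => A ω e.1.1 e.1.2) μ

/-- Feasible set of SDP-2′ on the node set `V` with `K` communities:
`⟨E_n, X⟩ = n² / K`, `diag X = 1`, `X ≥ 0` entrywise, `X ⪰ 0`, where `⟨A, X⟩ = tr (A X)`. -/
def sdpFeasible {V : Type*} [Fintype V] (K : ℕ) : Set (Matrix V V ℝ) :=
  {X | (allOnes V * X).trace = (Fintype.card V : ℝ) ^ 2 / K ∧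
    X.diag = 1 ∧ (∀ i j, 0 ≤ X i j) ∧ X.PosSemidef}

/-- Solution set of SDP-2′: the maximizers of `⟨A, X⟩ = tr (A X)` over the feasible set. -/
def sdpSolutions {V : Type*} [Fintype V] (K : ℕ) (A : Matrix V V ℝ) : Set (Matrix V V ℝ) :=
  {X | X ∈ sdpFeasible K ∧ ∀ Y ∈ sdpFeasible K, (A * Y).trace ≤ (A * X).trace}

/-- The rescaled probability `p m / log n`, where `n = m K`. -/
noncomputable def rescaled (m K : ℕ) (p : ℝ) : ℝ := p * m / Real.log ((m : ℝ) * K)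

open scoped Matrix

/-! ### Positive semidefinite matrices and traces -/

/-! Off the diagonal `A` is its mean plus a centred symmetric noise `W`. For feasible `X` the
difference `X - X₀` has zero diagonal and zero total sum, is nonpositive inside communities and
nonnegative outside. With `δ` the within-community mass lost (`massDefect`), its ℓ¹ norm is `2δ`,
and the mean part of the objective drops by exactly `(p - q) δ`.

The noise must gain less than that. Let `P = X₀ / m` be the projection onto the community
indicators. The compression `(1 - P) X (1 - P)` is positive semidefinite of trace `δ / m`, so it
gains at most `t δ / m` when `W ⪯ t`. What remains of `W` consists of community averages, with
entries at most `3 s / m` if `s` bounds the sums of `W` between a node and a community; ℓ¹–ℓ^∞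
duality gives `6 s δ / m`. Hence `t / m + 6 s / m < p - q` suffices (`sdpSolutions_eq_singleton`).

The bound `t ≲ √(d log n)`, with `d = p m + q n`, comes from a trace moment of order about `log n`,
estimated by a recursion along walks (`abs_integral_prod_mul_edgeMatrix_pow_le`); `s ≲ √(p m log n)`
comes from a Chernoff bound. -/

theorem Matrix.PosSemidef.trace_mul_nonneg {V : Type*} [Fintype V] {M Z : Matrix V V ℝ}
    (hM : M.PosSemidef) (hZ : Z.PosSemidef) : 0 ≤ (M * Z).trace := by
  obtain ⟨k, v, rfl⟩ := Matrix.posSemidef_iff_eq_sum_vecMulVec.1 hZ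
  rw [Matrix.mul_sum, Matrix.trace_sum]
  refine Finset.sum_nonneg fun i _ => ?_
  rw [Matrix.mul_vecMulVec, Matrix.trace_vecMulVec, dotProduct_comm]
  exact hM.dotProduct_mulVec_nonneg _

/-- A bound on an even trace moment bounds the spectrum. -/
theorem Matrix.IsHermitian.posSemidef_smul_one_sub {V : Type*} [Fintype V] [DecidableEq V]
    {W : Matrix V V ℝ} (hW : W.IsHermitian) {t : ℝ} (ht : 0 ≤ t) {k : ℕ} (hk : k ≠ 0)
    (h : (W ^ (2 * k)).trace ≤ t ^ (2 * k)) : (t • (1 : Matrix V V ℝ) - W).PosSemidef := by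
  set f := Unitary.conjStarAlgAut ℝ _ hW.eigenvectorUnitary with hf
  have hspec : W = f (Matrix.diagonal hW.eigenvalues) := hW.spectral_theorem
  have htr : (W ^ (2 * k)).trace = ∑ i, hW.eigenvalues i ^ (2 * k) := by
    conv_lhs => rw [hspec]
    rw [← map_pow, hf, Unitary.conjStarAlgAut_apply, Matrix.trace_mul_comm, ← mul_assoc]
    simp [Matrix.diagonal_pow, Matrix.trace]
  have hle : ∀ i, hW.eigenvalues i ≤ t := fun i => by
    refine (abs_le_of_sq_le_sq' ?_ ht).2
    refine le_of_pow_le_pow_left₀ hk (sq_nonneg t) ?_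
    rw [← pow_mul, ← pow_mul]
    refine le_trans ?_ (htr ▸ h)
    exact Finset.single_le_sum (f := fun i => hW.eigenvalues i ^ (2 * k))
      (fun i _ => by rw [pow_mul]; positivity) (Finset.mem_univ i)
  have hd : t • (1 : Matrix V V ℝ) - W = f (Matrix.diagonal fun i => t - hW.eigenvalues i) := by
    conv_lhs => rw [hspec]
    have : (Matrix.diagonal fun i => t - hW.eigenvalues i)
        = t • (1 : Matrix V V ℝ) - Matrix.diagonal hW.eigenvalues := by
      ext i j; by_cases hij : i = j <;> simp [hij, Matrix.diagonal]
    rw [this, map_sub, map_smul, map_one]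
  rw [hd, hf, Unitary.conjStarAlgAut_apply]
  exact (Matrix.PosSemidef.diagonal fun i => sub_nonneg.2 (hle i)).mul_mul_conjTranspose_same _

/-- Testing on `e_i - e_j` gives `2 - 2 X i j ≥ 0`. -/
theorem Matrix.PosSemidef.apply_le_one {V : Type*} [Fintype V] [DecidableEq V] {X : Matrix V V ℝ}
    (hX : X.PosSemidef) (hd : X.diag = 1) (i j : V) : X i j ≤ 1 := by
  have h := hX.dotProduct_mulVec_nonneg (Pi.single i 1 - Pi.single j 1)
  have hs : X j i = X i j := by simpa using hX.isHermitian.apply i j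
  have hi : X i i = 1 := congrFun hd i
  have hj : X j j = 1 := congrFun hd j
  simp [Matrix.mulVec_sub, sub_dotProduct, dotProduct_sub, hi, hj, hs] at h
  linarith

/-! ### The cluster matrix -/

theorem clusterMatrix_apply {m K : ℕ} (i j : Node m K) :
    clusterMatrix m K i j = if i.1 = j.1 then 1 else 0 := by
  simp [clusterMatrix, allOnes, Matrix.one_apply]

theorem clusterMatrix_isSymm (m K : ℕ) : (clusterMatrix m K).IsSymm := by
  ext i j
  simp [clusterMatrix_apply, eq_comm]

theorem clusterMatrix_mul_apply {m K : ℕ} (M : Matrix (Node m K) (Node m K) ℝ) (i j : Node m K) :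
    (clusterMatrix m K * M) i j = ∑ a, M (i.1, a) j := by
  simp [Matrix.mul_apply, clusterMatrix_apply, Fintype.sum_prod_type, Finset.sum_comm (γ := Fin K)]

theorem clusterMatrix_mul_self (m K : ℕ) :
    clusterMatrix m K * clusterMatrix m K = (m : ℝ) • clusterMatrix m K := by
  ext i j
  by_cases h : i.1 = j.1 <;> simp [clusterMatrix_mul_apply, clusterMatrix_apply, h]

theorem posSemidef_clusterMatrix (m K : ℕ) : (clusterMatrix m K).PosSemidef := by
  refine Matrix.PosSemidef.kronecker .one ?_
  have : allOnes (Fin m) = Matrix.vecMulVec 1 (star 1) := by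
    ext i j; simp [allOnes, Matrix.vecMulVec]
  rw [this]
  exact Matrix.posSemidef_vecMulVec_self_star _

theorem trace_allOnes_mul {V : Type*} [Fintype V] (X : Matrix V V ℝ) :
    (allOnes V * X).trace = ∑ i, ∑ j, X i j := by
  simp only [Matrix.trace, Matrix.diag, Matrix.mul_apply, allOnes, Matrix.of_apply, one_mul]
  exact Finset.sum_comm

theorem sum_clusterMatrix_apply {m K : ℕ} (i : Node m K) : ∑ j, clusterMatrix m K i j = m := by
  simp only [clusterMatrix_apply, Fintype.sum_prod_type]
  rw [Finset.sum_comm]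
  simp

theorem clusterMatrix_mem_sdpFeasible {m K : ℕ} (hK : 1 ≤ K) :
    clusterMatrix m K ∈ sdpFeasible (V := Node m K) K := by
  have hK' : (K : ℝ) ≠ 0 := by positivity
  refine ⟨?_, ?_, fun i j => ?_, posSemidef_clusterMatrix m K⟩
  · rw [trace_allOnes_mul]
    simp only [sum_clusterMatrix_apply]
    simp
    field_simp
  · ext i; simp [clusterMatrix_apply]
  · rw [clusterMatrix_apply]; split_ifs <;> norm_num

/-! ### Deterministic optimality condition -/

theorem trace_mul_eq_sum {V : Type*} [Fintype V] (M : Matrix V V ℝ) {Y : Matrix V V ℝ}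
    (hY : Y.IsSymm) : (M * Y).trace = ∑ i, ∑ j, M i j * Y i j := by
  simp only [Matrix.trace, Matrix.diag, Matrix.mul_apply]
  exact Finset.sum_congr rfl fun i _ => Finset.sum_congr rfl fun j _ => by rw [hY.apply]

section

variable {m K : ℕ} {X : Matrix (Node m K) (Node m K) ℝ}

/-- The within-community mass that a feasible matrix loses compared with the cluster matrix. -/
def massDefect (X : Matrix (Node m K) (Node m K) ℝ) : ℝ :=
  -∑ i, ∑ j, clusterMatrix m K i j * (X - clusterMatrix m K) i j

theorem sum_sub_clusterMatrix (hK : 1 ≤ K) (hX : X ∈ sdpFeasible (V := Node m K) K) :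
    ∑ i, ∑ j, (X - clusterMatrix m K) i j = 0 := by
  rw [← trace_allOnes_mul, Matrix.mul_sub, Matrix.trace_sub, hX.1,
    (clusterMatrix_mem_sdpFeasible hK).1, sub_self]

/-- Since `0 ≤ X ≤ 1`, the difference is nonpositive exactly where a sign flip is needed, namely
inside communities; the absolute value is therefore linear in `X`. -/
theorem abs_sub_clusterMatrix (hX : X ∈ sdpFeasible (V := Node m K) K) (i j : Node m K) :
    |(X - clusterMatrix m K) i j| =
      (X - clusterMatrix m K) i j - 2 * (clusterMatrix m K i j * (X - clusterMatrix m K) i j) := by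
  have h1 := hX.2.2.2.apply_le_one hX.2.1 i j
  have h0 := hX.2.2.1 i j
  rw [Matrix.sub_apply, clusterMatrix_apply]
  split_ifs
  · rw [abs_of_nonpos (by linarith)]; ring
  · rw [abs_of_nonneg (by linarith)]; ring

theorem sum_abs_sub_clusterMatrix (hK : 1 ≤ K) (hX : X ∈ sdpFeasible (V := Node m K) K) :
    ∑ i, ∑ j, |(X - clusterMatrix m K) i j| = 2 * massDefect X := by
  simp only [abs_sub_clusterMatrix hX, Finset.sum_sub_distrib, sum_sub_clusterMatrix hK hX,
    ← Finset.mul_sum, massDefect]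
  ring

theorem massDefect_pos (hK : 1 ≤ K) (hX : X ∈ sdpFeasible (V := Node m K) K)
    (hne : X ≠ clusterMatrix m K) : 0 < massDefect X := by
  have h := sum_abs_sub_clusterMatrix hK hX
  obtain ⟨i, j, hij⟩ : ∃ i j, X i j ≠ clusterMatrix m K i j := by
    by_contra! hc; exact hne (Matrix.ext hc)
  have : 0 < ∑ i, ∑ j, |(X - clusterMatrix m K) i j| :=
    Finset.sum_pos' (fun i _ => Finset.sum_nonneg fun j _ => abs_nonneg _)
      ⟨i, Finset.mem_univ _, Finset.sum_pos' (fun j _ => abs_nonneg _)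
        ⟨j, Finset.mem_univ _, abs_pos.2 (sub_ne_zero.2 hij)⟩⟩
  linarith

theorem trace_mul_sub_clusterMatrix_le (hK : 1 ≤ K) (hX : X ∈ sdpFeasible (V := Node m K) K)
    {M : Matrix (Node m K) (Node m K) ℝ} {b : ℝ} (hM : ∀ i j, |M i j| ≤ b) :
    (M * (X - clusterMatrix m K)).trace ≤ b * (2 * massDefect X) := by
  have hs : (X - clusterMatrix m K).IsSymm := by
    have := hX.2.2.2.isHermitian
    rw [Matrix.isHermitian_iff_isSymm] at this
    exact this.sub (clusterMatrix_isSymm m K)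
  rw [trace_mul_eq_sum M hs, ← sum_abs_sub_clusterMatrix hK hX, Finset.mul_sum]
  refine Finset.sum_le_sum fun i _ => ?_
  rw [Finset.mul_sum]
  refine Finset.sum_le_sum fun j _ => (le_abs_self _).trans ?_
  rw [abs_mul]
  exact mul_le_mul_of_nonneg_right (hM i j) (abs_nonneg _)

/-- The part of the noise orthogonal to the cluster directions is controlled by its largest
eigenvalue, the rest by the averages of the noise over communities. -/
theorem trace_noise_mul_sub_le (hm : 1 ≤ m) (hK : 1 ≤ K) (hX : X ∈ sdpFeasible (V := Node m K) K)
    {W : Matrix (Node m K) (Node m K) ℝ} (hW : W.IsSymm) {t s : ℝ}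
    (ht : (t • (1 : Matrix (Node m K) (Node m K) ℝ) - W).PosSemidef)
    (hs : ∀ k j, |∑ a, W (k, a) j| ≤ s) :
    (W * (X - clusterMatrix m K)).trace ≤ (t / m + 6 * (s / m)) * massDefect X := by
  have hm0 : (0 : ℝ) < m := by positivity
  have hXs : X.IsSymm := by
    have := hX.2.2.2.isHermitian
    rwa [Matrix.isHermitian_iff_isSymm] at this
  set J := clusterMatrix m K with hJ
  -- `P` is the orthogonal projection onto the span of the community indicators; multiplying by it
  -- averages over communities.
  set P := (m : ℝ)⁻¹ • J with hP
  have hJP : J = (m : ℝ) • P := by rw [hP, smul_smul, mul_inv_cancel₀ hm0.ne', one_smul]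
  have hPP : P * P = P := by
    rw [hP, smul_mul_smul_comm, hJ, clusterMatrix_mul_self, smul_smul]
    congr 1; field_simp
  have hPs : Pᵀ = P := by rw [hP, Matrix.transpose_smul, hJ, (clusterMatrix_isSymm m K).eq]
  have hPWa : ∀ i j, |(P * W) i j| ≤ s / m := fun i j => by
    rw [hP, Matrix.smul_mul, Matrix.smul_apply, hJ, clusterMatrix_mul_apply, smul_eq_mul, abs_mul,
      abs_of_pos (inv_pos.2 hm0), div_eq_inv_mul]
    exact mul_le_mul_of_nonneg_left (hs _ _) (inv_pos.2 hm0).le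
  have hWPa : ∀ i j, |(W * P) i j| ≤ s / m := fun i j => by
    have : (W * P) i j = (P * W) j i := by
      rw [← Matrix.transpose_apply (P * W), Matrix.transpose_mul, hPs, hW.eq]
    rw [this]; exact hPWa j i
  have hPWPa : ∀ i j, |(P * W * P) i j| ≤ s / m := fun i j => by
    rw [mul_assoc, hP, Matrix.smul_mul, Matrix.smul_apply, ← hP, hJ, clusterMatrix_mul_apply,
      smul_eq_mul, abs_mul, abs_of_pos (inv_pos.2 hm0), inv_mul_le_iff₀ hm0]
    refine (Finset.abs_sum_le_sum_abs _ _).trans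
      ((Finset.sum_le_sum fun a _ => hWPa _ _).trans_eq ?_)
    simp
  set Z := (1 - P) * X * (1 - P) with hZ
  have hZp : Z.PosSemidef := by
    have h1 : (1 - P)ᴴ = 1 - P := by
      rw [Matrix.conjTranspose_eq_transpose_of_trivial, Matrix.transpose_sub, hPs,
        Matrix.transpose_one]
    have h2 := hX.2.2.2.mul_mul_conjTranspose_same (1 - P)
    rwa [h1] at h2
  -- `tr Z = tr X - tr (P X)`, and `tr X = tr J = tr (P J)`, which leaves `-tr (P (X - J))`.
  have hZtr : Z.trace = massDefect X / m := by
    have h1 : Z.trace = (X - P * X).trace := by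
      rw [hZ, Matrix.trace_mul_comm, ← mul_assoc]
      congr 1
      have : (1 - P) * (1 - P) = 1 - P := by
        rw [mul_sub, sub_mul, sub_mul, hPP]; simp
      rw [this, sub_mul, one_mul]
    have h2 : (J * (X - J)).trace = - massDefect X := by
      rw [trace_mul_eq_sum J (hXs.sub (clusterMatrix_isSymm m K)), massDefect, neg_neg]
    have h3 : (P * J).trace = X.trace := by
      rw [hJP, Matrix.mul_smul, hPP, ← hJP, Matrix.trace, Matrix.trace, hX.2.1,
        (clusterMatrix_mem_sdpFeasible hK).2.1]
    have h4 : (P * (X - J)).trace = - (massDefect X / m) := by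
      rw [hP, Matrix.smul_mul, Matrix.trace_smul, h2, smul_eq_mul]; ring
    rw [Matrix.mul_sub, Matrix.trace_sub, h3] at h4
    rw [h1, Matrix.trace_sub]
    linarith
  have hWZ : (W * Z).trace ≤ t / m * massDefect X := by
    have h := ht.trace_mul_nonneg hZp
    rw [Matrix.sub_mul, Matrix.smul_mul, one_mul, Matrix.trace_sub, Matrix.trace_smul, hZtr,
      smul_eq_mul] at h
    calc _ ≤ t * (massDefect X / m) := by linarith
      _ = _ := by ring
  -- `(1 - P) J = 0`, so `Z` is also the compression of `X - J`; cyclicity of the trace then moves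
  -- the projections onto `W`.
  have hdec : (W * (X - J)).trace = (W * Z).trace + ((P * W + W * P - P * W * P) * (X - J)).trace := by
    have hZ' : Z = (1 - P) * (X - J) * (1 - P) := by
      have : (1 - P) * J = 0 := by rw [hJP, Matrix.mul_smul, sub_mul, one_mul, hPP, sub_self, smul_zero]
      rw [mul_sub (1 - P) X J, this, sub_zero]
    rw [hZ']
    have e1 : W * ((1 - P) * (X - J) * (1 - P)) =
        W * (X - J) - W * P * (X - J) - (W * (X - J)) * P + (W * P * (X - J)) * P := by
      noncomm_ring
    rw [e1, sub_mul, add_mul, Matrix.trace_add, Matrix.trace_sub, Matrix.trace_sub,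
      Matrix.trace_mul_comm _ P, Matrix.trace_mul_comm _ P, Matrix.trace_sub, Matrix.trace_add]
    simp only [mul_assoc]
    ring
  have hrest := trace_mul_sub_clusterMatrix_le hK hX (M := P * W + W * P - P * W * P)
    (b := 3 * (s / m)) fun i j => by
      rw [Matrix.sub_apply, Matrix.add_apply]
      have h1 := hPWa i j
      have h2 := hWPa i j
      have h3 := hPWPa i j
      rw [abs_le] at *
      constructor <;> linarith
  rw [hdec]
  calc _ ≤ t / m * massDefect X + 3 * (s / m) * (2 * massDefect X) := add_le_add hWZ hrest
    _ = _ := by ring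

/-- Deterministic sufficient condition for exact recovery. -/
theorem sdpSolutions_eq_singleton (hm : 1 ≤ m) (hK : 1 ≤ K) {p q t s : ℝ}
    {A W : Matrix (Node m K) (Node m K) ℝ} (hW : W.IsSymm)
    (hA : ∀ i j, i ≠ j → A i j = (if i.1 = j.1 then p else q) + W i j)
    (ht : (t • (1 : Matrix (Node m K) (Node m K) ℝ) - W).PosSemidef)
    (hs : ∀ k j, |∑ a, W (k, a) j| ≤ s) (hpq : t / m + 6 * (s / m) < p - q) :
    sdpSolutions K A = {clusterMatrix m K} := by
  have key : ∀ X ∈ sdpFeasible (V := Node m K) K, X ≠ clusterMatrix m K →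
      (A * X).trace < (A * clusterMatrix m K).trace := fun X hX hne => by
    have hXs : X.IsSymm := by
      have := hX.2.2.2.isHermitian
      rwa [Matrix.isHermitian_iff_isSymm] at this
    have hYs := hXs.sub (clusterMatrix_isSymm m K)
    have hsum : (A * (X - clusterMatrix m K)).trace =
        q * ∑ i, ∑ j, (X - clusterMatrix m K) i j
          + (p - q) * ∑ i, ∑ j, clusterMatrix m K i j * (X - clusterMatrix m K) i j
          + (W * (X - clusterMatrix m K)).trace := by
      rw [trace_mul_eq_sum A hYs, trace_mul_eq_sum W hYs]
      simp only [Finset.mul_sum, ← Finset.sum_add_distrib]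
      refine Finset.sum_congr rfl fun i _ => Finset.sum_congr rfl fun j _ => ?_
      -- The diagonals of `A` and `W` do not matter because `X - X₀` vanishes there.
      by_cases hij : i = j
      · subst hij
        have h1 : X i i = 1 := congrFun hX.2.1 i
        have : (X - clusterMatrix m K) i i = 0 := by
          simp [Matrix.sub_apply, clusterMatrix_apply, h1]
        simp [this]
      · rw [hA i j hij, clusterMatrix_apply]
        split_ifs <;> ring
    have hnoise := trace_noise_mul_sub_le hm hK hX hW ht hs
    have hδ := massDefect_pos hK hX hne
    have hc : ∑ i, ∑ j, clusterMatrix m K i j * (X - clusterMatrix m K) i j = -massDefect X := by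
      rw [massDefect, neg_neg]
    rw [sum_sub_clusterMatrix hK hX, hc, Matrix.mul_sub, Matrix.trace_sub] at hsum
    nlinarith [mul_lt_mul_of_pos_right hpq hδ]
  have h0 := clusterMatrix_mem_sdpFeasible (m := m) hK
  ext X
  refine ⟨fun hX => ?_, ?_⟩
  · by_contra hne
    exact (key X hX.1 hne).not_ge (hX.2 _ h0)
  · rintro rfl
    refine ⟨h0, fun Y hY => ?_⟩
    by_cases h : Y = clusterMatrix m K
    · rw [h]
    · exact (key Y hY h).le

end

/-! ### Trace moments of sparse random matrices -/

section TraceMoment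

variable {V E Ω : Type*}

/-- The random matrix whose `(v, u)` entry is the variable attached to the edge joining `v` and
`u`, or zero if there is none. -/
def edgeMatrix (edge : V → V → Option E) (ξ : E → Ω → ℝ) (ω : Ω) : Matrix V V ℝ :=
  Matrix.of fun v u => (edge v u).elim 0 fun e => ξ e ω

/-- Bound for the `k`-th moment of a centred variable of variance at most `p` and modulus at most
one. The factor `β` discounts edges that a walk has used exactly once so far. -/
def momentWeight (p β : ℝ) : ℕ → ℝ
  | 0 => 1
  | 1 => p * β
  | _ + 2 => p

theorem momentWeight_nonneg {p β : ℝ} (hp : 0 ≤ p) (hβ : 0 < β) :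
    ∀ k, 0 ≤ momentWeight p β k
  | 0 => zero_le_one
  | 1 => mul_nonneg hp hβ.le
  | _ + 2 => hp

/-- One more use of an edge costs `p β` if the edge is fresh. A second use pays back the discount,
`p = (p β) β⁻¹`, and later uses are free because `β⁻¹ ≥ 1`. The factor `k` makes the revisit cost
summable over edges by total multiplicity. -/
theorem momentWeight_succ_le {p β : ℝ} (hp : 0 ≤ p) (hβ : 0 < β) (hβ1 : β ≤ 1) :
    ∀ k : ℕ, momentWeight p β (k + 1) ≤ momentWeight p β k * (p * β + k * β⁻¹)
  | 0 => by simp [momentWeight]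
  | 1 => by
    have : p * β * (p * β + (1 : ℕ) * β⁻¹) = (p * β) ^ 2 + p := by
      push_cast; field_simp
    simp only [momentWeight, this]
    nlinarith [sq_nonneg (p * β)]
  | k + 2 => by
    have h1 : 1 ≤ β⁻¹ := (one_le_inv₀ hβ).2 hβ1
    have h2 : (1 : ℝ) ≤ ((k + 2 : ℕ) : ℝ) := by push_cast; linarith [k.cast_nonneg (α := ℝ)]
    have h3 : 1 ≤ ((k + 2 : ℕ) : ℝ) * β⁻¹ := one_le_mul_of_one_le_of_one_le h2 h1
    exact le_mul_of_one_le_right hp (by linarith [mul_nonneg hp hβ.le])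

theorem sum_option_elim_eq [Fintype V] [Fintype E] {edge : V → Option E}
    (hinj : ∀ u u' e, edge u = some e → edge u' = some e → u = u') (g : E → ℝ)
    [DecidablePred fun e => ∃ u, edge u = some e] :
    ∑ u, (edge u).elim 0 g = ∑ e with ∃ u, edge u = some e, g e := by
  classical
  have h : ∀ u, (edge u).elim 0 g = ∑ e, if edge u = some e then g e else 0 := fun u => by
    cases hu : edge u <;> simp
  simp only [h]
  rw [Finset.sum_comm, Finset.sum_filter]
  refine Finset.sum_congr rfl fun e _ => ?_
  split_ifs with he
  · obtain ⟨u, hu⟩ := he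
    rw [Finset.sum_eq_single u (fun u' _ hne => if_neg fun h' => hne (hinj _ _ _ h' hu)) (by simp),
      if_pos hu]
  · exact Finset.sum_eq_zero fun u _ => if_neg fun h' => he ⟨u, h'⟩

theorem sum_option_elim_le [Fintype V] [Fintype E] {edge : V → Option E}
    (hinj : ∀ u u' e, edge u = some e → edge u' = some e → u = u') {g : E → ℝ}
    (hg : ∀ e, 0 ≤ g e) : ∑ u, (edge u).elim 0 g ≤ ∑ e, g e := by
  classical
  rw [sum_option_elim_eq hinj]
  exact Finset.sum_le_sum_of_subset_of_nonneg (Finset.filter_subset _ _) fun e _ _ => hg e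

variable [MeasurableSpace Ω] {μ : Measure Ω} [IsProbabilityMeasure μ]

/-- The first moment vanishes, so any nonnegative weight is allowed there and `β` stays free; higher
powers are dominated by the square. -/
theorem abs_integral_pow_le {X : Ω → ℝ} (hX : Measurable X) (hb : ∀ ω, |X ω| ≤ 1)
    (h0 : ∫ ω, X ω ∂μ = 0) {p β : ℝ} (hβ : 0 < β) (h2 : ∫ ω, X ω ^ 2 ∂μ ≤ p) (k : ℕ) :
    |∫ ω, X ω ^ k ∂μ| ≤ momentWeight p β k := by
  have hi : ∀ k, Integrable (fun ω => X ω ^ k) μ := fun k =>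
    Integrable.of_bound (by fun_prop) 1 (.of_forall fun ω => by
      rw [norm_pow, Real.norm_eq_abs]; exact pow_le_one₀ (abs_nonneg _) (hb ω))
  have hp : 0 ≤ p := le_trans (integral_nonneg fun ω => sq_nonneg _) h2
  match k with
  | 0 => simp [momentWeight]
  | 1 => simpa [momentWeight, h0] using mul_nonneg hp hβ.le
  | k + 2 =>
    refine (abs_integral_le_integral_abs).trans (le_trans ?_ h2)
    refine integral_mono (hi _).abs (hi 2) fun ω => ?_
    show |X ω ^ (k + 2)| ≤ X ω ^ 2
    rw [abs_pow, ← sq_abs (X ω)]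
    exact pow_le_pow_of_le_one (abs_nonneg _) (hb ω) (by omega)

variable [Fintype V] [DecidableEq V] [Fintype E] [DecidableEq E]
  {edge : V → V → Option E} {ξ : E → Ω → ℝ} {p : E → ℝ}

/-- Expected weight of walks of length `L`, given that edge `e` was already used `f e` times. -/
theorem abs_integral_prod_mul_edgeMatrix_pow_le
    (hinj : ∀ v u u' e, edge v u = some e → edge v u' = some e → u = u')
    (hind : iIndepFun ξ μ) (hmeas : ∀ e, Measurable (ξ e)) (hb : ∀ e ω, |ξ e ω| ≤ 1)
    (h0 : ∀ e, ∫ ω, ξ e ω ∂μ = 0) (h2 : ∀ e, ∫ ω, ξ e ω ^ 2 ∂μ ≤ p e)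
    {d β α : ℝ} (hβ : 0 < β) (hβ1 : β ≤ 1) {N : ℕ}
    (hd : ∀ v, ∑ u, (edge v u).elim 0 p ≤ d) (hα : d * β + N * β⁻¹ ≤ α) (L : ℕ) :
    ∀ (f : E → ℕ) (v w : V), L + ∑ e, f e ≤ N →
      Integrable (fun ω => (∏ e, ξ e ω ^ f e) * (edgeMatrix edge ξ ω ^ L) v w) μ ∧
      |∫ ω, (∏ e, ξ e ω ^ f e) * (edgeMatrix edge ξ ω ^ L) v w ∂μ| ≤
        (∏ e, momentWeight (p e) β (f e)) * α ^ L := by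
  have hp : ∀ e, 0 ≤ p e := fun e => le_trans (integral_nonneg fun ω => sq_nonneg _) (h2 e)
  have hw : ∀ f : E → ℕ, 0 ≤ ∏ e, momentWeight (p e) β (f e) := fun f =>
    Finset.prod_nonneg fun e _ => momentWeight_nonneg (hp e) hβ _
  induction L with
  | zero =>
    intro f v w _
    have hint : Integrable (fun ω => ∏ e, ξ e ω ^ f e) μ :=
      Integrable.of_bound (by fun_prop) 1 (.of_forall fun ω => by
        rw [Real.norm_eq_abs, Finset.abs_prod]
        exact Finset.prod_le_one (fun _ _ => abs_nonneg _) fun e _ => by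
          rw [abs_pow]; exact pow_le_one₀ (abs_nonneg _) (hb e ω))
    have hprod : |∫ ω, ∏ e, ξ e ω ^ f e ∂μ| ≤ ∏ e, momentWeight (p e) β (f e) := by
      rw [hind.integral_fun_prod_comp (f := fun e x => x ^ f e) (fun e => (hmeas e).aemeasurable)
        (fun e => by fun_prop), Finset.abs_prod]
      exact Finset.prod_le_prod (fun _ _ => abs_nonneg _) fun e _ =>
        abs_integral_pow_le (hmeas e) (hb e) (h0 e) hβ (h2 e) _
    simp only [pow_zero, mul_one, Matrix.one_apply]
    by_cases hvw : v = w
    · simpa [hvw] using ⟨hint, hprod⟩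
    · simpa [hvw] using hw f
  | succ L ih =>
    intro f v w hN
    have hα0 : 0 ≤ α := by
      refine le_trans (add_nonneg (mul_nonneg ?_ hβ.le) (by positivity)) hα
      refine le_trans (Finset.sum_nonneg fun u _ => ?_) (hd v)
      cases edge v u <;> simp [hp]
    -- Splitting off the first step `v → u` raises the multiplicity of its edge by one and shortens
    -- the walk by one, so `L + ∑ f` is preserved.
    set g : V → Ω → ℝ := fun u ω => (edge v u).elim 0 fun e =>
      (∏ e', ξ e' ω ^ Function.update f e (f e + 1) e') * (edgeMatrix edge ξ ω ^ L) u w with hg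
    have hsum : (fun ω => (∏ e, ξ e ω ^ f e) * (edgeMatrix edge ξ ω ^ (L + 1)) v w) =
        fun ω => ∑ u, g u ω := by
      funext ω
      rw [pow_succ', Matrix.mul_apply, Finset.mul_sum]
      refine Finset.sum_congr rfl fun u _ => ?_
      simp only [hg]
      cases hu : edge v u with
      | none => simp [edgeMatrix, hu]
      | some e =>
        have h1 : ∏ e', ξ e' ω ^ Function.update f e (f e + 1) e' = (∏ e', ξ e' ω ^ f e') * ξ e ω := by
          rw [← Finset.mul_prod_erase _ _ (Finset.mem_univ e),
            ← Finset.mul_prod_erase _ (fun e' => ξ e' ω ^ f e') (Finset.mem_univ e),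
            Finset.prod_congr rfl fun e' he' => by
              rw [Function.update_of_ne (Finset.ne_of_mem_erase he')], Function.update_self]
          ring
        simp only [Option.elim, h1]
        rw [show edgeMatrix edge ξ ω v u = ξ e ω by simp [edgeMatrix, hu]]
        ring
    have hupd : ∀ e, L + ∑ e', Function.update f e (f e + 1) e' ≤ N := fun e => by
      have : ∑ e', Function.update f e (f e + 1) e' = ∑ e', f e' + 1 := by
        rw [← Finset.add_sum_erase _ _ (Finset.mem_univ e),
          ← Finset.add_sum_erase _ f (Finset.mem_univ e),
          Finset.sum_congr rfl fun e' he' => by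
            rw [Function.update_of_ne (Finset.ne_of_mem_erase he')], Function.update_self]
        ring
      omega
    have hgi : ∀ u, Integrable (g u) μ := fun u => by
      simp only [hg]
      cases hu : edge v u with
      | none => simp
      | some e => exact (ih _ u w (hupd e)).1
    have hgb : ∀ u, |∫ ω, g u ω ∂μ| ≤
        (edge v u).elim 0 (fun e => p e * β + f e * β⁻¹) *
          ((∏ e, momentWeight (p e) β (f e)) * α ^ L) := fun u => by
      simp only [hg]
      cases hu : edge v u with
      | none => simp
      | some e =>
        refine (ih _ u w (hupd e)).2.trans ?_
        simp only [Option.elim]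
        rw [← mul_assoc]
        refine mul_le_mul_of_nonneg_right ?_ (pow_nonneg hα0 _)
        rw [← Finset.mul_prod_erase _ _ (Finset.mem_univ e),
          ← Finset.mul_prod_erase _ (fun e' => momentWeight (p e') β (f e')) (Finset.mem_univ e),
          Finset.prod_congr rfl fun e' he' => by
            rw [Function.update_of_ne (Finset.ne_of_mem_erase he')], Function.update_self, ← mul_assoc]
        refine mul_le_mul_of_nonneg_right ?_
          (Finset.prod_nonneg fun e _ => momentWeight_nonneg (hp e) hβ _)
        rw [mul_comm (_ + _)]
        exact momentWeight_succ_le (hp e) hβ hβ1 _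
    -- Fresh edges contribute at most `d β`. Distinct neighbours use distinct edges, so revisits
    -- contribute at most `β⁻¹ ∑ f ≤ N β⁻¹`.
    have htot : ∑ u, (edge v u).elim 0 (fun e => p e * β + f e * β⁻¹) ≤ α := by
      have h1 : ∀ u, (edge v u).elim 0 (fun e => p e * β + f e * β⁻¹) =
          (edge v u).elim 0 p * β + (edge v u).elim 0 (fun e => f e * β⁻¹) := fun u => by
        cases edge v u <;> simp
      simp only [h1, Finset.sum_add_distrib, ← Finset.sum_mul]
      refine (add_le_add (mul_le_mul_of_nonneg_right (hd v) hβ.le) ?_).trans hα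
      refine (sum_option_elim_le (hinj v) fun e => by positivity).trans ?_
      rw [← Finset.sum_mul]
      refine mul_le_mul_of_nonneg_right ?_ (by positivity)
      exact_mod_cast (by omega : ∑ e, f e ≤ N)
    rw [hsum]
    refine ⟨integrable_finsetSum _ fun u _ => hgi u, ?_⟩
    rw [integral_finsetSum _ fun u _ => hgi u]
    refine (Finset.abs_sum_le_sum_abs _ _).trans ((Finset.sum_le_sum fun u _ => hgb u).trans ?_)
    rw [← Finset.sum_mul, pow_succ', mul_left_comm (∏ e, momentWeight (p e) β (f e))]
    exact mul_le_mul_of_nonneg_right htot (mul_nonneg (hw f) (pow_nonneg hα0 _))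

/-- The choice `β = √(N / d)` balances `d β` against `N β⁻¹`; `N ≤ d` is what makes `β ≤ 1`. -/
theorem integrable_trace_edgeMatrix_pow_and_integral_le
    (hinj : ∀ v u u' e, edge v u = some e → edge v u' = some e → u = u')
    (hind : iIndepFun ξ μ) (hmeas : ∀ e, Measurable (ξ e)) (hb : ∀ e ω, |ξ e ω| ≤ 1)
    (h0 : ∀ e, ∫ ω, ξ e ω ∂μ = 0) (h2 : ∀ e, ∫ ω, ξ e ω ^ 2 ∂μ ≤ p e)
    {d : ℝ} {N : ℕ} (hN : N ≠ 0) (hNd : N ≤ d) (hd : ∀ v, ∑ u, (edge v u).elim 0 p ≤ d) :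
    Integrable (fun ω => (edgeMatrix edge ξ ω ^ N).trace) μ ∧
      ∫ ω, (edgeMatrix edge ξ ω ^ N).trace ∂μ ≤ Fintype.card V * (2 * √(d * N)) ^ N := by
  have hN0 : (0 : ℝ) < N := by positivity
  have hd0 : 0 < d := hN0.trans_le hNd
  have hs1 := Real.sqrt_pos.2 hd0
  have hs2 := Real.sqrt_pos.2 hN0
  have hα : d * (√N / √d) + N * (√N / √d)⁻¹ ≤ 2 * √(d * N) := by
    rw [Real.sqrt_mul hd0.le, inv_div]
    apply le_of_eq
    have e1 : d * (√N / √d) = √d * √N := by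
      nth_rewrite 1 [← Real.mul_self_sqrt hd0.le]; field_simp
    have e2 : N * (√d / √N) = √d * √N := by
      nth_rewrite 1 [← Real.mul_self_sqrt hN0.le]; field_simp
    rw [e1, e2]; ring
  have key := fun v => abs_integral_prod_mul_edgeMatrix_pow_le hinj hind hmeas hb h0 h2
    (div_pos hs2 hs1) ((div_le_one hs1).2 (Real.sqrt_le_sqrt hNd)) hd hα N (fun _ => 0) v v (by simp)
  simp only [pow_zero, Finset.prod_const_one, one_mul, momentWeight] at key
  simp only [Matrix.trace, Matrix.diag]
  refine ⟨integrable_finsetSum _ fun v _ => (key v).1, ?_⟩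
  rw [integral_finsetSum _ fun v _ => (key v).1]
  refine (Finset.sum_le_sum fun v _ => (le_abs_self _).trans (key v).2).trans_eq ?_
  simp

/-- Markov's inequality for an even trace moment. -/
theorem measureReal_lt_trace_edgeMatrix_pow_le
    (hinj : ∀ v u u' e, edge v u = some e → edge v u' = some e → u = u')
    (hsymm : ∀ v u, edge v u = edge u v)
    (hind : iIndepFun ξ μ) (hmeas : ∀ e, Measurable (ξ e)) (hb : ∀ e ω, |ξ e ω| ≤ 1)
    (h0 : ∀ e, ∫ ω, ξ e ω ∂μ = 0) (h2 : ∀ e, ∫ ω, ξ e ω ^ 2 ∂μ ≤ p e)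
    {d : ℝ} {k : ℕ} (hk : k ≠ 0) (hkd : 2 * k ≤ d) (hd : ∀ v, ∑ u, (edge v u).elim 0 p ≤ d) :
    μ.real {ω | √(4 * Real.exp 1 * (d * (2 * k))) ^ (2 * k) < (edgeMatrix edge ξ ω ^ (2 * k)).trace}
      ≤ Fintype.card V * Real.exp (-k) := by
  have hk0 : (0 : ℝ) < k := by positivity
  have hd0 : 0 < d := by linarith
  obtain ⟨hi, hle⟩ := integrable_trace_edgeMatrix_pow_and_integral_le hinj hind hmeas hb h0 h2
    (N := 2 * k) (by omega) (by push_cast; exact hkd) hd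
  have hnn : ∀ ω, 0 ≤ (edgeMatrix edge ξ ω ^ (2 * k)).trace := fun ω => by
    have hs : (edgeMatrix edge ξ ω ^ k)ᴴ = edgeMatrix edge ξ ω ^ k := by
      rw [Matrix.conjTranspose_pow]
      congr 1
      ext v u
      simp [edgeMatrix, hsymm u v]
    have := (Matrix.posSemidef_conjTranspose_mul_self (edgeMatrix edge ξ ω ^ k)).trace_nonneg
    rwa [hs, ← pow_add, ← two_mul] at this
  -- The threshold is `exp k` times the per-vertex moment bound `(2 √(d · 2k)) ^ (2k)`, hence the
  -- factor `exp (-k)`.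
  set T := √(4 * Real.exp 1 * (d * (2 * k))) ^ (2 * k) with hT
  have hT' : T = (4 * Real.exp 1 * (d * (2 * k))) ^ k := by
    rw [hT, pow_mul, Real.sq_sqrt (by positivity)]
  have hTpos : 0 < T := by rw [hT']; positivity
  have hM := mul_meas_ge_le_integral_of_nonneg (.of_forall hnn) hi T
  have hmono : μ.real {ω | T < (edgeMatrix edge ξ ω ^ (2 * k)).trace} ≤
      μ.real {ω | T ≤ (edgeMatrix edge ξ ω ^ (2 * k)).trace} :=
    measureReal_mono fun ω (hω : T < _) => show T ≤ _ from hω.le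
  refine hmono.trans (le_of_mul_le_mul_left (hM.trans (hle.trans_eq ?_)) hTpos)
  rw [pow_mul, mul_pow 2, Real.sq_sqrt (by positivity), hT', ← neg_one_mul, mul_comm (-1 : ℝ),
    Real.exp_nat_mul, mul_left_comm (_ ^ k), ← mul_pow, Real.exp_neg]
  congr 2
  push_cast
  field_simp
  norm_num

end TraceMoment

/-! ### Exponential tail bounds -/

section Chernoff

variable {E Ω : Type*} [MeasurableSpace Ω] {μ : Measure Ω} [IsProbabilityMeasure μ]

/-- Integrate `exp x ≤ 1 + x + x²`, valid for `|x| ≤ 1`; the linear term vanishes. -/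
theorem mgf_le_exp_of_abs_le_one {X : Ω → ℝ} (hX : Measurable X) (hb : ∀ ω, |X ω| ≤ 1)
    (h0 : ∫ ω, X ω ∂μ = 0) {v l : ℝ} (h2 : ∫ ω, X ω ^ 2 ∂μ ≤ v) (hl : 0 ≤ l) (hl1 : l ≤ 1) :
    mgf X μ l ≤ Real.exp (v * l ^ 2) := by
  have hi : ∀ k, Integrable (fun ω => X ω ^ k) μ := fun k =>
    Integrable.of_bound (by fun_prop) 1 (.of_forall fun ω => by
      rw [norm_pow, Real.norm_eq_abs]; exact pow_le_one₀ (abs_nonneg _) (hb ω))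
  have hi1 : Integrable X μ := by simpa using hi 1
  have habs : ∀ ω, |l * X ω| ≤ 1 := fun ω => by
    rw [abs_mul, abs_of_nonneg hl]
    exact mul_le_one₀ hl1 (abs_nonneg _) (hb ω)
  have hie : Integrable (fun ω => Real.exp (l * X ω)) μ :=
    Integrable.of_bound (by fun_prop) (Real.exp 1) (.of_forall fun ω => by
      rw [Real.norm_eq_abs, Real.abs_exp]
      exact Real.exp_le_exp.2 ((le_abs_self _).trans (habs ω)))
  have hlin : Integrable (fun ω => 1 + l * X ω) μ := (integrable_const _).add (hi1.const_mul _)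
  have hquad : Integrable (fun ω => 1 + l * X ω + l ^ 2 * X ω ^ 2) μ :=
    hlin.add ((hi 2).const_mul _)
  calc mgf X μ l ≤ ∫ ω, (1 + l * X ω + l ^ 2 * X ω ^ 2) ∂μ := by
        refine integral_mono hie hquad fun ω => ?_
        have := (abs_le.1 (Real.abs_exp_sub_one_sub_id_le (habs ω))).2
        show Real.exp (l * X ω) ≤ _
        rw [mul_pow] at this
        linarith
    _ = 1 + l ^ 2 * ∫ ω, X ω ^ 2 ∂μ := by
        rw [integral_add hlin ((hi 2).const_mul _),
          integral_add (integrable_const _) (hi1.const_mul _), integral_const_mul,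
          integral_const_mul, h0]
        simp
    _ ≤ 1 + v * l ^ 2 := by nlinarith [sq_nonneg l]
    _ ≤ _ := by linarith [Real.add_one_le_exp (v * l ^ 2)]

theorem measureReal_le_sum_le_exp {ξ : E → Ω → ℝ} (hind : iIndepFun ξ μ)
    (hmeas : ∀ e, Measurable (ξ e)) (hb : ∀ e ω, |ξ e ω| ≤ 1) (h0 : ∀ e, ∫ ω, ξ e ω ∂μ = 0)
    {v : ℝ} (hv : 0 ≤ v) (h2 : ∀ e, ∫ ω, ξ e ω ^ 2 ∂μ ≤ v) (S : Finset E) {m : ℕ} (hS : S.card ≤ m)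
    {l : ℝ} (hl : 0 ≤ l) (hl1 : l ≤ 1) (s : ℝ) :
    μ.real {ω | s ≤ ∑ e ∈ S, ξ e ω} ≤ Real.exp (m * v * l ^ 2 - l * s) := by
  have hint : Integrable (fun ω => Real.exp (l * (∑ e ∈ S, ξ e) ω)) μ :=
    Integrable.of_bound (by fun_prop) (Real.exp (l * S.card)) (.of_forall fun ω => by
      rw [Real.norm_eq_abs, Real.abs_exp, Finset.sum_apply]
      refine Real.exp_le_exp.2 (mul_le_mul_of_nonneg_left ?_ hl)
      refine (Finset.sum_le_sum fun e _ => (le_abs_self _).trans (hb e ω)).trans_eq ?_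
      simp)
  have h := measure_ge_le_exp_mul_mgf s hl hint
  simp only [Finset.sum_apply] at h
  refine h.trans ?_
  rw [hind.mgf_sum hmeas, sub_eq_neg_add, Real.exp_add, ← neg_mul]
  refine mul_le_mul_of_nonneg_left ?_ (Real.exp_pos _).le
  calc _ ≤ ∏ e ∈ S, Real.exp (v * l ^ 2) := Finset.prod_le_prod (fun _ _ => mgf_nonneg) fun e _ =>
        mgf_le_exp_of_abs_le_one (hmeas e) (hb e) (h0 e) (h2 e) hl hl1
    _ = Real.exp (S.card * v * l ^ 2) := by
        rw [Finset.prod_const, ← Real.exp_nat_mul, mul_assoc]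
    _ ≤ _ := Real.exp_le_exp.2 (by gcongr)

theorem measureReal_lt_abs_sum_le_exp {ξ : E → Ω → ℝ} (hind : iIndepFun ξ μ)
    (hmeas : ∀ e, Measurable (ξ e)) (hb : ∀ e ω, |ξ e ω| ≤ 1) (h0 : ∀ e, ∫ ω, ξ e ω ∂μ = 0)
    {v : ℝ} (hv : 0 ≤ v) (h2 : ∀ e, ∫ ω, ξ e ω ^ 2 ∂μ ≤ v) (S : Finset E) {m : ℕ} (hS : S.card ≤ m)
    {l : ℝ} (hl : 0 ≤ l) (hl1 : l ≤ 1) (s : ℝ) :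
    μ.real {ω | s < |∑ e ∈ S, ξ e ω|} ≤ 2 * Real.exp (m * v * l ^ 2 - l * s) := by
  have h1 := measureReal_le_sum_le_exp hind hmeas hb h0 hv h2 S hS hl hl1 s
  have h3 := measureReal_le_sum_le_exp (ξ := fun e ω => -ξ e ω)
    (hind.comp (fun _ x => -x) fun _ => measurable_neg) (fun e => (hmeas e).neg)
    (fun e ω => by rw [abs_neg]; exact hb e ω) (fun e => by rw [integral_neg, h0, neg_zero]) hv
    (fun e => by simpa using h2 e) S hS hl hl1 s
  have hsub : {ω | s < |∑ e ∈ S, ξ e ω|} ⊆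
      {ω | s ≤ ∑ e ∈ S, ξ e ω} ∪ {ω | s ≤ ∑ e ∈ S, -ξ e ω} := fun ω hω => by
    rcases lt_abs.1 (show s < |_| from hω) with h | h
    · exact Or.inl h.le
    · right
      show s ≤ _
      rw [Finset.sum_neg_distrib]
      exact h.le
  linarith [(measureReal_mono hsub).trans (measureReal_union_le (μ := μ) _ _)]

/-- Mean and variance of a centred Bernoulli variable. -/
theorem integral_sub_eq_zero_and_integral_sq_le {B : Ω → ℝ} (hB : Measurable B)
    (hbin : ∀ ω, B ω = 0 ∨ B ω = 1) {π : ℝ} (hπ : μ.real {ω | B ω = 1} = π) :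
    ∫ ω, (B ω - π) ∂μ = 0 ∧ ∫ ω, (B ω - π) ^ 2 ∂μ ≤ π := by
  have hset : MeasurableSet {ω | B ω = 1} := hB (measurableSet_singleton 1)
  have hind : B = {ω | B ω = 1}.indicator fun _ => 1 := by
    funext ω
    rcases hbin ω with h | h <;> simp [Set.indicator, h]
  have hi : Integrable B μ := Integrable.of_bound hB.aestronglyMeasurable 1 (.of_forall fun ω => by
    rcases hbin ω with h | h <;> simp [h])
  have hint : ∫ ω, B ω ∂μ = π := by
    rw [hind, integral_indicator_const _ hset, hπ]; simp
  refine ⟨by rw [integral_sub hi (integrable_const _), hint]; simp, ?_⟩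
  have hsq : (fun ω => (B ω - π) ^ 2) = fun ω => (1 - 2 * π) * B ω + π ^ 2 := by
    funext ω
    rcases hbin ω with h | h <;> rw [h] <;> ring
  rw [hsq, integral_add (hi.const_mul _) (integrable_const _), integral_const_mul, hint]
  simp
  nlinarith [sq_nonneg π]

end Chernoff

/-! ### The noise of the planted partition model -/

section Model

variable {m K : ℕ}

/-- The ordered pair of nodes that carries the edge variable of `v` and `u`. -/
def nodeEdge (v u : Node m K) : Option {e : Node m K × Node m K // toLex e.1 < toLex e.2} :=
  if h : toLex v < toLex u then some ⟨(v, u), h⟩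
  else if h : toLex u < toLex v then some ⟨(u, v), h⟩ else none

theorem nodeEdge_comm (v u : Node m K) : nodeEdge v u = nodeEdge u v := by
  unfold nodeEdge
  by_cases h1 : toLex v < toLex u
  · simp [h1, h1.not_gt]
  · simp [h1]

theorem nodeEdge_inj (v u u' : Node m K) (e) (h : nodeEdge v u = some e)
    (h' : nodeEdge v u' = some e) : u = u' := by
  unfold nodeEdge at h h'
  split_ifs at h h' <;> simp only [Option.some.injEq] at h h' <;> subst h <;>
    simp only [Subtype.mk.injEq, Prod.mk.injEq] at h' <;> grind

/-- Edge probability of the planted partition model. -/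
def edgeProb (p q : ℝ) (v u : Node m K) : ℝ := if v.1 = u.1 then p else q

/-- The centred edge variables. -/
def edgeNoise {Ω : Type*} (p q : ℝ) (A : Ω → Matrix (Node m K) (Node m K) ℝ)
    (e : {e : Node m K × Node m K // toLex e.1 < toLex e.2}) (ω : Ω) : ℝ :=
  A ω e.1.1 e.1.2 - edgeProb p q e.1.1 e.1.2

/-- Supplies the variance budget `d` of the trace bound; charging `q` for nodes of the same
community too is harmless. -/
theorem sum_nodeEdge_elim_le {p q : ℝ} (hp : 0 ≤ p) (hq : 0 ≤ q) (v : Node m K) :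
    ∑ u, (nodeEdge v u).elim 0 (fun e => edgeProb p q e.1.1 e.1.2) ≤ p * m + q * (m * K) := by
  have h : ∀ u, (nodeEdge v u).elim 0 (fun e => edgeProb p q e.1.1 e.1.2) ≤
      p * clusterMatrix m K v u + q := fun u => by
    rw [clusterMatrix_apply]
    unfold nodeEdge edgeProb
    split_ifs <;> simp_all [eq_comm, add_nonneg]
  refine (Finset.sum_le_sum fun u _ => h u).trans_eq ?_
  rw [Finset.sum_add_distrib, ← Finset.mul_sum, sum_clusterMatrix_apply]
  simp
  ring

variable {Ω : Type*} [MeasurableSpace Ω] {μ : Measure Ω}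
  {p q : ℝ} {A : Ω → Matrix (Node m K) (Node m K) ℝ}

theorem IsBalancedPlantedPartition.eq_add_edgeMatrix (hA : IsBalancedPlantedPartition μ m K p q A)
    (ω : Ω) (i j : Node m K) (hij : i ≠ j) :
    A ω i j = (if i.1 = j.1 then p else q) + edgeMatrix nodeEdge (edgeNoise p q A) ω i j := by
  have hs := (hA.symm ω).apply i j
  rcases lt_or_gt_of_ne (toLex.injective.ne hij) with h | h
  · simp [edgeMatrix, nodeEdge, h, edgeNoise, edgeProb]
  · simp [edgeMatrix, nodeEdge, h, h.not_gt, edgeNoise, edgeProb, hs, eq_comm]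

theorem IsBalancedPlantedPartition.measurable_edgeNoise
    (hA : IsBalancedPlantedPartition μ m K p q A) (e) : Measurable (edgeNoise p q A e) :=
  (hA.measurable _ _).sub_const _

theorem IsBalancedPlantedPartition.iIndepFun_edgeNoise
    (hA : IsBalancedPlantedPartition μ m K p q A) : iIndepFun (edgeNoise p q A) μ :=
  hA.indep.comp (fun e x => x - edgeProb p q e.1.1 e.1.2) fun _ => by fun_prop

theorem edgeProb_mem_Icc (hp : p ∈ Set.Icc (0 : ℝ) 1) (hq : q ∈ Set.Icc (0 : ℝ) 1)
    (v u : Node m K) : edgeProb p q v u ∈ Set.Icc (0 : ℝ) 1 := by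
  unfold edgeProb; split_ifs <;> assumption

theorem IsBalancedPlantedPartition.abs_edgeNoise_le
    (hA : IsBalancedPlantedPartition μ m K p q A) (hp : p ∈ Set.Icc (0 : ℝ) 1)
    (hq : q ∈ Set.Icc (0 : ℝ) 1) (e) (ω : Ω) : |edgeNoise p q A e ω| ≤ 1 := by
  have hne : e.1.1 ≠ e.1.2 := fun h => e.2.ne (congrArg toLex h)
  have hP := edgeProb_mem_Icc hp hq e.1.1 e.1.2
  rw [edgeNoise, abs_le]
  rcases hA.binary ω _ _ hne with h | h <;> rw [h] <;> constructor <;> linarith [hP.1, hP.2]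

variable [IsProbabilityMeasure μ]

theorem IsBalancedPlantedPartition.integral_edgeNoise
    (hA : IsBalancedPlantedPartition μ m K p q A) (e) :
    ∫ ω, edgeNoise p q A e ω ∂μ = 0 ∧
      ∫ ω, edgeNoise p q A e ω ^ 2 ∂μ ≤ edgeProb p q e.1.1 e.1.2 := by
  have hne : e.1.1 ≠ e.1.2 := fun h => e.2.ne (congrArg toLex h)
  exact integral_sub_eq_zero_and_integral_sq_le (hA.measurable _ _)
    (fun ω => hA.binary ω _ _ hne) (hA.prob_edge _ _ hne)

/-- Tail bound for the noise between a node and a community. -/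
theorem IsBalancedPlantedPartition.measureReal_lt_abs_sum_edgeMatrix_le
    (hA : IsBalancedPlantedPartition μ m K p q A) (hp : p ∈ Set.Icc (0 : ℝ) 1)
    (hq : q ∈ Set.Icc (0 : ℝ) 1) (hqp : q ≤ p) {l : ℝ} (hl : 0 ≤ l) (hl1 : l ≤ 1) (s : ℝ)
    (k : Fin K) (j : Node m K) :
    μ.real {ω | s < |∑ a, edgeMatrix nodeEdge (edgeNoise p q A) ω (k, a) j|} ≤
      2 * Real.exp (m * p * l ^ 2 - l * s) := by
  classical
  have hinj : ∀ a a' : Fin m, ∀ e, nodeEdge (k, a) j = some e → nodeEdge (k, a') j = some e →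
      a = a' := fun a a' e h h' => by
    rw [nodeEdge_comm] at h h'
    exact (Prod.mk.inj (nodeEdge_inj j _ _ e h h')).2
  -- The edges from `j` to community `k`: at most `m`, since `j` itself contributes none.
  set S : Finset {e : Node m K × Node m K // toLex e.1 < toLex e.2} :=
    {e | ∃ a : Fin m, nodeEdge (k, a) j = some e} with hS
  have hsum : ∀ ω, ∑ a, edgeMatrix nodeEdge (edgeNoise p q A) ω (k, a) j =
      ∑ e ∈ S, edgeNoise p q A e ω := fun ω =>
    sum_option_elim_eq hinj fun e => edgeNoise p q A e ω
  have hcard : S.card ≤ m := by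
    have h := sum_option_elim_eq hinj fun _ => (1 : ℝ)
    rw [Finset.sum_const, nsmul_eq_mul, mul_one] at h
    have h1 : ∑ a : Fin m, (nodeEdge (k, a) j).elim 0 (fun _ => (1 : ℝ)) ≤ ∑ _a : Fin m, 1 :=
      Finset.sum_le_sum fun a _ => by cases nodeEdge (k, a) j <;> simp
    rw [h] at h1
    simp only [Finset.sum_const, Finset.card_univ, Fintype.card_fin, nsmul_eq_mul, mul_one] at h1
    exact_mod_cast h1
  simp only [hsum]
  refine measureReal_lt_abs_sum_le_exp hA.iIndepFun_edgeNoise hA.measurable_edgeNoise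
    (hA.abs_edgeNoise_le hp hq) (fun e => (hA.integral_edgeNoise e).1) hp.1
    (fun e => (hA.integral_edgeNoise e).2.trans ?_) S hcard hl hl1 s
  unfold edgeProb
  split_ifs
  exacts [le_rfl, hqp]

/-- Failure probability of exact recovery in terms of the tuning parameters of the two
concentration bounds. -/
theorem IsBalancedPlantedPartition.one_sub_le_measureReal
    (hA : IsBalancedPlantedPartition μ m K p q A) (hm : 1 ≤ m) (hK : 1 ≤ K)
    (hp : p ∈ Set.Icc (0 : ℝ) 1) (hq : q ∈ Set.Icc (0 : ℝ) 1) (hqp : q ≤ p) {k : ℕ} (hk : k ≠ 0)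
    (hkd : 2 * k ≤ p * m + q * (m * K)) {l s : ℝ} (hl : 0 ≤ l) (hl1 : l ≤ 1)
    (hpq : √(4 * Real.exp 1 * ((p * m + q * (m * K)) * (2 * k))) / m + 6 * (s / m) < p - q) :
    1 - (m * K * Real.exp (-k) + K * (m * K) * (2 * Real.exp (m * p * l ^ 2 - l * s))) ≤
      μ.real {ω | sdpSolutions K (A ω) = {clusterMatrix m K}} := by
  set W := edgeMatrix nodeEdge (edgeNoise p q A) with hW
  set t := √(4 * Real.exp 1 * ((p * m + q * (m * K)) * (2 * k))) with ht
  set G := {ω | sdpSolutions K (A ω) = {clusterMatrix m K}}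
  set B := {ω | t ^ (2 * k) < (W ω ^ (2 * k)).trace}
  set D : Fin K × Node m K → Set Ω := fun x => {ω | s < |∑ a, W ω (x.1, a) x.2|} with hD
  have hsymm : ∀ ω, (W ω).IsSymm := fun ω => by
    ext i j
    simp [hW, edgeMatrix, nodeEdge_comm j i]
  have hcover : Set.univ ⊆ G ∪ (B ∪ ⋃ x, D x) := fun ω _ => by
    by_contra hω
    simp only [Set.mem_union, Set.mem_iUnion, not_or, not_exists] at hω
    obtain ⟨hG, hB, hDω⟩ := hω
    refine hG (sdpSolutions_eq_singleton hm hK (hsymm ω) (hA.eq_add_edgeMatrix ω) ?_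
      (fun k j => not_lt.1 (hDω (k, j))) hpq)
    exact Matrix.IsHermitian.posSemidef_smul_one_sub
      (Matrix.isHermitian_iff_isSymm.2 (hsymm ω)) (Real.sqrt_nonneg _) hk (not_lt.1 hB)
  have hBle : μ.real B ≤ m * K * Real.exp (-k) := by
    have h := measureReal_lt_trace_edgeMatrix_pow_le (V := Node m K)
      (p := fun e => edgeProb p q e.1.1 e.1.2) nodeEdge_inj nodeEdge_comm hA.iIndepFun_edgeNoise
      hA.measurable_edgeNoise (hA.abs_edgeNoise_le hp hq) (fun e => (hA.integral_edgeNoise e).1)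
      (fun e => (hA.integral_edgeNoise e).2) hk hkd (sum_nodeEdge_elim_le hp.1 hq.1)
    refine h.trans_eq ?_
    simp [mul_comm]
  have hDle : μ.real (⋃ x, D x) ≤ K * (m * K) * (2 * Real.exp (m * p * l ^ 2 - l * s)) := by
    refine (measureReal_iUnion_fintype_le _).trans ((Finset.sum_le_sum fun x _ =>
      hA.measureReal_lt_abs_sum_edgeMatrix_le hp hq hqp hl hl1 s x.1 x.2).trans_eq ?_)
    simp [mul_comm, mul_left_comm]
  -- Subadditivity holds for arbitrary sets, so the recovery event need not be shown measurable.
  have h1 : (1 : ℝ) ≤ μ.real (G ∪ (B ∪ ⋃ x, D x)) := by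
    rw [← probReal_univ (μ := μ)]; exact measureReal_mono hcover
  have h2 := measureReal_union_le (μ := μ) G (B ∪ ⋃ x, D x)
  have h3 := measureReal_union_le (μ := μ) B (⋃ x, D x)
  linarith

end Model

/-! ### Choice of parameters and the consistency theorem -/

theorem mainTheorem2 :
    ∃ C C' c r : ℝ, 0 < C ∧ 0 < C' ∧ 0 < c ∧ 0 < r ∧
      ∀ {Ω : Type*} [MeasurableSpace Ω] (μ : Measure Ω) [IsProbabilityMeasure μ]
        (m K : ℕ) (_ : 1 ≤ m) (_ : 1 ≤ K) (p q : ℝ)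
        (_ : p ∈ Set.Icc (0 : ℝ) 1) (_ : q ∈ Set.Icc (0 : ℝ) 1)
        (A : Ω → Matrix (Node m K) (Node m K) ℝ)
        (_ : IsBalancedPlantedPartition μ m K p q A)
        (c₁ c₂ C₁ C₂ : ℝ) (_ : 0 < c₁) (_ : 0 < c₂)
        (_ : C₁ = max C' (4 / 9 * (c₁ + 1)))
        (_ : C₂ = C + max (√(4 * (c₁ + 1))) (3 * √(4 * (c₂ + 1))))
        (_ : C₁ ≤ rescaled m K p)
        (_ : C₂ * (√(rescaled m K p) + √(rescaled m K q * K)) <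
          rescaled m K p - rescaled m K q),
        1 - c * (K * (m : ℝ) ^ (-r) + ((m : ℝ) * K) ^ (-r))
            - ((m : ℝ) * K) ^ (-c₁) - 2 * (m : ℝ)⁻¹ * ((m : ℝ) * K) ^ (-c₂)
          ≤ μ.real {ω | sdpSolutions K (A ω) = {clusterMatrix m K}} := by
  refine ⟨40, 20, 3, 1, by norm_num, by norm_num, by norm_num, by norm_num, ?_⟩
  intro Ω _ μ _ m K hm hK p q hp hq A hA c₁ c₂ C₁ C₂ _ _ hC₁ hC₂ h₁ h₂
  have hm1 : (1 : ℝ) ≤ m := by exact_mod_cast hm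
  have hK1 : (1 : ℝ) ≤ K := by exact_mod_cast hK
  have hm0 : (0 : ℝ) < m := by linarith
  have hn1 : (1 : ℝ) ≤ m * K := one_le_mul_of_one_le_of_one_le hm1 hK1
  set n : ℝ := m * K with hn
  have hn0 : 0 < n := by linarith
  set L := Real.log n with hL
  have hC20 : 20 ≤ rescaled m K p := (le_max_left _ _).trans (hC₁ ▸ h₁)
  -- For `n = 1` division by `log 1 = 0` makes the rescaled probability `0`, contradicting the lower
  -- bound `20`.
  have hLne : L ≠ 0 := fun h => by
    rw [rescaled, ← hn, ← hL, h, div_zero] at hC20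
    norm_num at hC20
  have hL0 : 0 < L := lt_of_le_of_ne (Real.log_nonneg hn1) hLne.symm
  have hLhalf : 1 / 2 ≤ L := by
    have h2 : (2 : ℝ) ≤ n := by
      have h : 1 < m * K := by
        by_contra hc
        have h1 : m * K = 1 := le_antisymm (not_lt.1 hc) (Nat.mul_pos hm hK)
        have h2 : n = 1 := by rw [hn]; exact_mod_cast h1
        rw [hL, h2, Real.log_one] at hLne
        exact hLne rfl
      rw [hn]; exact_mod_cast h
    have := Real.log_le_log (by norm_num) h2
    linarith [Real.log_two_gt_d9]
  have hpm : 20 * L ≤ p * m := by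
    rw [rescaled, ← hn, ← hL, le_div_iff₀ hL0] at hC20
    exact hC20
  have hpm0 : 0 < p * m := by linarith
  have hqn0 : 0 ≤ q * n := mul_nonneg hq.1 hn0.le
  set a := √(p * m) with ha
  set b := √(q * n) with hb
  set g := √L with hg
  have ha0 : 0 < a := Real.sqrt_pos.2 hpm0
  have hb0 : 0 ≤ b := Real.sqrt_nonneg _
  have hg0 : 0 < g := Real.sqrt_pos.2 hL0
  have ha2 : a ^ 2 = p * m := Real.sq_sqrt hpm0.le
  have hb2 : b ^ 2 = q * n := Real.sq_sqrt hqn0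
  have hg2 : g ^ 2 = L := Real.sq_sqrt hL0.le
  -- The separation hypothesis multiplied by `log n`, keeping only `C₂ ≥ 40`.
  have hgap : 40 * (a + b) * g < (p - q) * m := by
    have e1 : √(rescaled m K p) = a / g := by
      rw [rescaled, ← hn, ← hL, Real.sqrt_div hpm0.le]
    have e2 : √(rescaled m K q * K) = b / g := by
      rw [rescaled, ← hn, ← hL, div_mul_eq_mul_div, mul_assoc, ← hn, Real.sqrt_div hqn0]
    have e3 : rescaled m K p - rescaled m K q = (p - q) * m / g ^ 2 := by
      rw [rescaled, rescaled, ← hn, ← hL, hg2]; ring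
    rw [e1, e2, e3, ← add_div] at h₂
    have h40 : 40 ≤ C₂ := by
      rw [hC₂]
      linarith [(Real.sqrt_nonneg (4 * (c₁ + 1))).trans
        (le_max_left (√(4 * (c₁ + 1))) (3 * √(4 * (c₂ + 1))))]
    have h3 : 40 * ((a + b) / g) < (p - q) * m / g ^ 2 :=
      lt_of_le_of_lt (mul_le_mul_of_nonneg_right h40 (by positivity)) h₂
    rw [lt_div_iff₀ (by positivity)] at h3
    calc 40 * (a + b) * g = 40 * ((a + b) / g) * g ^ 2 := by field_simp
      _ < _ := h3
  have hqp : q ≤ p := by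
    have : 0 < (p - q) * m := lt_of_le_of_lt (by positivity) hgap
    linarith [(pos_iff_pos_of_mul_pos this).2 hm0]
  -- Then `exp (-k) ≤ n⁻²` beats the dimension factor `n`, and `L ≥ 1/2` absorbs the rounding: `k ≤
  -- 2 L + 1 ≤ 4 L`.
  set k := ⌈2 * L⌉₊ with hkdef
  have hkL : 2 * L ≤ k := Nat.le_ceil _
  have hk4 : (k : ℝ) ≤ 4 * L := by linarith [Nat.ceil_lt_add_one (a := 2 * L) (by linarith)]
  have hk0 : k ≠ 0 := by
    rintro h; rw [h] at hkL; norm_num at hkL; linarith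
  have ht : √(4 * Real.exp 1 * ((p * m + q * n) * (2 * k))) ≤ 10 * (a + b) * g := by
    refine Real.sqrt_le_iff.2 ⟨by positivity, ?_⟩
    have he : Real.exp 1 ≤ 2.72 := by linarith [Real.exp_one_lt_d9]
    calc 4 * Real.exp 1 * ((p * m + q * n) * (2 * k))
        ≤ 4 * 2.72 * ((p * m + q * n) * (2 * (4 * L))) := by gcongr
      _ = 87.04 * (a ^ 2 + b ^ 2) * g ^ 2 := by rw [ha2, hb2, hg2]; ring
      _ ≤ 100 * (a + b) ^ 2 * g ^ 2 := by
          gcongr ?_ * g ^ 2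
          nlinarith [mul_nonneg ha0.le hb0, sq_nonneg a, sq_nonneg b]
      _ = _ := by ring
  have hl1 : 2 * g / a ≤ 1 := by
    rw [div_le_one ha0]
    refine abs_le_of_sq_le_sq' ?_ ha0.le |>.2
    rw [mul_pow, hg2, ha2]; linarith
  -- For `s = 4 a g` the exponent `m p l² - l s` is minimal at `l = 2 g / a`, with value `-4 L`. The
  -- gap condition holds because `10 (a + b) + 24 a ≤ 40 (a + b)`, and `2 k ≤ 8 L ≤ p m`.
  have hmain := hA.one_sub_le_measureReal hm hK hp hq hqp hk0
    (by rw [← hn]; linarith) (l := 2 * g / a) (s := 4 * a * g) (by positivity) hl1 (by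
      rw [← hn, ← mul_div_assoc, ← add_div, div_lt_iff₀ hm0]
      nlinarith [mul_nonneg hb0 hg0.le, mul_pos ha0 hg0])
  refine le_trans ?_ hmain
  have hexp : Real.exp (m * p * (2 * g / a) ^ 2 - 2 * g / a * (4 * a * g)) = (n ^ 4)⁻¹ := by
    have : m * p * (2 * g / a) ^ 2 - 2 * g / a * (4 * a * g) = -((4 : ℕ) * L) := by
      rw [mul_comm (m : ℝ) p, ← ha2, ← hg2]
      push_cast
      field_simp
      ring
    rw [this, Real.exp_neg, Real.exp_nat_mul, hL, Real.exp_log hn0]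
  have hexpk : Real.exp (-k) ≤ (n ^ 2)⁻¹ := by
    calc Real.exp (-k) ≤ Real.exp (-((2 : ℕ) * L)) := Real.exp_le_exp.2 (by push_cast; linarith)
      _ = _ := by rw [Real.exp_neg, Real.exp_nat_mul, hL, Real.exp_log hn0]
  have hB : n * Real.exp (-k) ≤ n⁻¹ :=
    (mul_le_mul_of_nonneg_left hexpk hn0.le).trans_eq (by field_simp)
  have hD : K * n * (2 * (n ^ 4)⁻¹) ≤ 2 * n⁻¹ := by
    have hKn : (K : ℝ) ≤ n := le_mul_of_one_le_left (by linarith) hm1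
    calc K * n * (2 * (n ^ 4)⁻¹) ≤ n * n * (2 * (n ^ 4)⁻¹) := by gcongr
      _ = 2 * n⁻¹ * n⁻¹ := by field_simp
      _ ≤ 2 * n⁻¹ := mul_le_of_le_one_right (by positivity) (inv_le_one_of_one_le₀ hn1)
  -- The total failure probability is at most `n⁻¹ + 2 n⁻¹`, which is the `c n^{-r}` term with `c =
  -- 3`, `r = 1`.
  rw [← hn, hexp, Real.rpow_neg_one, Real.rpow_neg_one]
  have r1 : 0 ≤ K * (m : ℝ)⁻¹ := by positivity
  have r2 : 0 ≤ n ^ (-c₁) := by positivity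
  have r3 : 0 ≤ 2 * (m : ℝ)⁻¹ * n ^ (-c₂) := by positivity
  linarith
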